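/- Let $p$ be a prime, let $k$ be a perfect commutative ring of characteristic $p$ (that is, the Frobenius $x\mapsto x^p$ is bijective on $k$), and let $e,m\geq 1$ be integers. Let $\mathfrak{g}$ be a group scheme over $k$ whose underlying scheme is $\operatorname{Spec}\big(k[X_1,\dots,X_e]/(X_1^{p^m},\dots,X_e^{p^m})\big)$, i.e. $k[X_1,\dots,X_e]/(X_1^{p^m},\dots,X_e^{p^m})$ carries a Hopf algebra structure over $k$. A $\mathfrak{g}$-field is a field $K$ that is a $k$-algebra, together with an action over $k$ of $\mathfrak{g}$ on $\operatorname{Spec}(K)$. On coordinate rings the action is a $k$-algebra homomorphism $\mathbb{D}:K\to K[X_1,\dots,X_e]/(X_1^{p^m},\dots,X_e^{p^m})$, which we write as $\mathbb{D}(r)=\sum_{\mathbf i}D_{\mathbf i}(r)\mathbf{X}^{\mathbf i}$. A homomorphism (necessarily an embedding) of $\mathfrak{g}$-fields is a $k$-algebra homomorphism commuting with all $D_{\mathbf i}$; a $\mathfrak{g}$-field extension is such an embedding. A $\mathfrak{g}$-field $K$ is strict if its field of constants $\ker D_{(1,0,\dots,0)}\cap\dots\cap\ker D_{(0,\dots,0,1)}$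 equals $K^p=\{x^p : x\in K\}$. Let $K\to L_1$ and $K\to L_2$ be $\mathfrak{g}$-field extensions and assume that $K$ is strict. Then $L_1$ and $L_2$ can be $\mathfrak{g}$-amalgamated over $K$ into a $\mathfrak{g}$-field: there are a $\mathfrak{g}$-field $M$ and homomorphisms of $\mathfrak{g}$-fields $L_1\to M$ and $L_2\to M$ whose composites with $K\to L_1$ and $K\to L_2$ coincide. -/

import Mathlib

open scoped TensorProduct

noncomputable section

/-- The truncated polynomial ring `k[X_1, …, X_e] / (X_1 ^ N, …, X_e ^ N)`. -/
abbrev TruncPoly (k : Type*) [CommRing k] (e N : ℕ) : Type _ :=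
  MvPolynomial (Fin e) k ⧸
    Ideal.span (Set.range fun i : Fin e => (MvPolynomial.X i ^ N : MvPolynomial (Fin e) k))

namespace TruncPoly

variable {k : Type*} [CommRing k] {e N : ℕ}

theorem coeff_eq_zero_of_mem {n : Fin e →₀ ℕ} (hn : ∀ i, n i < N) {f : MvPolynomial (Fin e) k}
    (hf : f ∈ Ideal.span (Set.range fun i : Fin e =>
      (MvPolynomial.X i ^ N : MvPolynomial (Fin e) k))) :
    MvPolynomial.coeff n f = 0 := by
  classical
  induction hf using Submodule.span_induction generalizing n with
  | mem x hx =>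
    obtain ⟨i, rfl⟩ := hx
    rw [MvPolynomial.coeff_X_pow, if_neg]
    rintro rfl
    simpa using hn i
  | zero => simp
  | add x y _ _ hx hy => simp [hx hn, hy hn]
  | smul a x _ hx =>
    rw [smul_eq_mul, MvPolynomial.coeff_mul]
    refine Finset.sum_eq_zero fun q hq => ?_
    have hle : q.2 ≤ n := by
      rw [← Finset.HasAntidiagonal.mem_antidiagonal.mp hq]
      exact le_add_self
    rw [hx fun i => (hle i).trans_lt (hn i), mul_zero]

/-- The coefficient of the monomial `X ^ n` (where `n_i < N` for all `i`) of a truncated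
polynomial; it is set to `0` for the other `n`, whose monomial vanishes. -/
def coeff (n : Fin e →₀ ℕ) : TruncPoly k e N →ₗ[k] k :=
  open Classical in
  if hn : ∀ i, n i < N then
    ((Submodule.restrictScalars k (Ideal.span (Set.range fun i : Fin e =>
      (MvPolynomial.X i ^ N : MvPolynomial (Fin e) k)))).liftQ (MvPolynomial.lcoeff k n)
        fun _ hf => coeff_eq_zero_of_mem hn hf) ∘ₗ
      (Submodule.Quotient.restrictScalarsEquiv k (Ideal.span (Set.range fun i : Fin e =>
        (MvPolynomial.X i ^ N : MvPolynomial (Fin e) k)))).symm.toLinearMap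
  else 0

theorem coeff_mk {n : Fin e →₀ ℕ} (hn : ∀ i, n i < N) (f : MvPolynomial (Fin e) k) :
    coeff n (Ideal.Quotient.mk _ f : TruncPoly k e N) = MvPolynomial.coeff n f := by
  rw [coeff, dif_pos hn]
  rfl

end TruncPoly

/-- A `𝔤`-derivation on a commutative `k`-algebra `R`, where `𝔤 = Spec H` is an affine group scheme
over `k`: an action `𝔤 × Spec R → Spec R` over `k`, given by its map of coordinate rings
`R → H ⊗ R`. -/
structure GDerivation (k H R : Type*) [CommRing k] [CommRing H] [HopfAlgebra k H]
    [CommRing R] [Algebra k R] where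
  /-- The map of coordinate rings `R → H ⊗ R` of the action. -/
  toAlgHom : R →ₐ[k] H ⊗[k] R
  /-- The unit of `𝔤` acts trivially. -/
  counit_coact : ∀ r : R,
    TensorProduct.lid k R ((Coalgebra.counit (R := k) (A := H)).rTensor R (toAlgHom r)) = r
  /-- Mixed associativity `(g h) x = g (h x)`. -/
  coassoc : ∀ r : R,
    TensorProduct.assoc k H H R ((Coalgebra.comul (R := k) (A := H)).rTensor R (toAlgHom r)) =
      toAlgHom.toLinearMap.lTensor H (toAlgHom r)

namespace GDerivation

variable {k H R S : Type*} [CommRing k] [CommRing H] [HopfAlgebra k H]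
  [CommRing R] [Algebra k R] [CommRing S] [Algebra k S] {e N : ℕ}

/-- The components `D_n : R → R` of a `𝔤`-derivation in coordinates `φ : k[X]/(X ^ N) ≃ H`, so that
`D (r) = ∑ X ^ n ⊗ D_n (r)`. -/
def component (φ : TruncPoly k e N ≃ₐ[k] H) (D : GDerivation k H R) (n : Fin e →₀ ℕ) :
    R →ₗ[k] R :=
  (TensorProduct.lid k R).toLinearMap ∘ₗ
    ((TruncPoly.coeff n).comp φ.symm.toLinearMap).rTensor R ∘ₗ D.toAlgHom.toLinearMap

/-- The constants: the common zeros of `D_{(1,0,…,0)}, …, D_{(0,…,0,1)}`. -/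
def constants (φ : TruncPoly k e N ≃ₐ[k] H) (D : GDerivation k H R) : Set R :=
  {r | ∀ i : Fin e, D.component φ (Finsupp.single i 1) r = 0}

/-- `(R, D)` is strict (in characteristic `p`) if its constants are exactly the `p`-th powers. -/
def IsStrict (p : ℕ) (φ : TruncPoly k e N ≃ₐ[k] H) (D : GDerivation k H R) : Prop :=
  D.constants φ = Set.range fun r : R => r ^ p

/-- A `k`-algebra homomorphism `f : R → S` is a `𝔤`-homomorphism if it commutes with the
`𝔤`-derivations; a `𝔤`-field extension is a `𝔤`-homomorphism between `𝔤`-fields. -/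
def IsHom (D : GDerivation k H R) (E : GDerivation k H S) (f : R →ₐ[k] S) : Prop :=
  ∀ r : R, E.toAlgHom (f r) = f.toLinearMap.lTensor H (D.toAlgHom r)

end GDerivation

end

universe u v w x y

/-!
Write `𝔤 = Spec H`. The amalgam is a localization of the ring `L₁ ⊗[K] L₂`, on which `𝔤` acts
because the two coactions agree on `K` (`GDerivation.exists_tensorProduct`).

Strictness enters only to show that this ring is reduced. The components of weight one of an action
are derivations (`GDerivation.derivation`), which kill `p`-th powers. As the constants of `K` are
its `p`-th powers, a Wronskian argument (`LinearIndependent.pow_char_of_derivation`) shows that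
elements of `L₂` linearly independent over `K` have linearly independent `p`-th powers, so `L₂ / K`
is separable. Writing an element of `L₁ ⊗[K] L₂` in terms of a basis of `L₂`, one sees that its
`p`-th power is nonzero if the element is nonzero
(`TensorProduct.isReduced_of_linearIndependent_pow`).

Since `k` is perfect, hence reduced, the unit of `𝔤` is the origin of `Spec (k[X] / (X ^ p ^ m))`,
and `H` is infinitesimal (`TruncPoly.isInfinitesimal`). A coaction `R → H ⊗ R` is then the identity
modulo nilpotents, so it sends elements that are invertible in a localization of `R` to units and
extends to the localization (`GDerivation.exists_localization`). The localization of the nonzero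
reduced ring `L₁ ⊗[K] L₂` at a minimal prime ideal is a field, and this is the amalgam.
-/

open scoped TensorProduct

/-! ### Linear independence of `p`-th powers and reduced tensor products -/

/-- Let `L / K` be an extension of fields of characteristic `p` with derivations `δ j` of `L` that
restrict to maps `d j` of `K`. If the common zeros of the `d j` are `p`-th powers in `K`, then
taking `p`-th powers preserves linear independence over `K`, that is, `L / K` is separable. This is
the Wronskian argument: the derivations kill all `p`-th powers of `L`, so they shorten a linear
relation between such powers as long as one of its coefficients is not a constant. -/
theorem LinearIndependent.pow_char_of_derivation {K L ι κ : Type*} [Field K] [Field L]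
    [Algebra K L] (p : ℕ) [Fact p.Prime] [CharP L p] (d : κ → K → K) (δ : κ → Derivation ℤ L L)
    (hδ : ∀ j a, δ j (algebraMap K L a) = algebraMap K L (d j a))
    (hd : ∀ a, (∀ j, d j a = 0) → ∃ c, c ^ p = a)
    {v : ι → L} (hv : LinearIndependent K v) : LinearIndependent K fun i => v i ^ p := by
  classical
  have hp : p ≠ 0 := (Fact.out : p.Prime).ne_zero
  have hpow (j : κ) (x : L) : δ j (x ^ p) = 0 := by
    rw [Derivation.leibniz_pow, ← Nat.cast_smul_eq_nsmul L, CharP.cast_eq_zero, zero_smul]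
  rw [linearIndependent_iff']
  intro s
  induction s using Finset.induction_on with
  | empty => simp
  | insert i₀ s hi₀ ih =>
    intro a ha
    by_cases h₀ : a i₀ = 0
    · rw [Finset.sum_insert hi₀, h₀, zero_smul, zero_add] at ha
      simpa [h₀] using ih a ha
    exfalso
    -- Normalize the relation so that its coefficient at `i₀` is `1`.
    obtain ⟨b, hb₀, hb⟩ : ∃ b : ι → K, b i₀ = 1 ∧ ∑ i ∈ insert i₀ s, b i • v i ^ p = 0 := by
      refine ⟨fun i => (a i₀)⁻¹ * a i, inv_mul_cancel₀ h₀, ?_⟩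
      simp only [mul_smul, ← Finset.smul_sum, ha, smul_zero]
    have hd₁ (j : κ) : d j 1 = 0 := by
      apply (algebraMap K L).injective
      rw [← hδ, map_one, Derivation.map_one_eq_zero, map_zero]
    have hconst : ∀ i ∈ insert i₀ s, ∀ j, d j (b i) = 0 := by
      intro i hi j
      have h := congrArg (δ j) hb
      simp only [map_sum, Algebra.smul_def (A := L) (R := K), Derivation.leibniz, hpow, hδ,
        map_zero, smul_zero, zero_add] at h
      rw [Finset.sum_insert hi₀, hb₀, hd₁, map_zero, smul_zero, zero_add] at h
      rcases Finset.mem_insert.mp hi with rfl | hi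
      · rw [hb₀, hd₁]
      · refine ih (fun i => d j (b i)) ?_ i hi
        rw [← h]
        exact Finset.sum_congr rfl fun i _ => by rw [Algebra.smul_def, smul_eq_mul, mul_comm]
    choose c hc using fun i : ι => show ∃ c : K, i ∈ insert i₀ s → c ^ p = b i by
      by_cases hi : i ∈ insert i₀ s
      · obtain ⟨c, hc⟩ := hd (b i) (hconst i hi)
        exact ⟨c, fun _ => hc⟩
      · exact ⟨0, fun h => (hi h).elim⟩
    -- The relation is the `p`-th power of the relation with coefficients `c`.
    have hsum : (∑ i ∈ insert i₀ s, c i • v i) ^ p = 0 := by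
      rw [sum_pow_char, ← hb]
      exact Finset.sum_congr rfl fun i hi => by rw [smul_pow, hc i hi]
    have hc₀ := linearIndependent_iff'.mp hv _ c (eq_zero_of_pow_eq_zero hsum) i₀
      (Finset.mem_insert_self i₀ s)
    have := hc i₀ (Finset.mem_insert_self i₀ s)
    rw [hc₀, hb₀, zero_pow hp] at this
    exact zero_ne_one this

/-- One half of Mac Lane's criterion: `A ⊗ L` is reduced for every reduced `A` if taking `p`-th
powers preserves linear independence in `L`. -/
theorem TensorProduct.isReduced_of_linearIndependent_pow {K A : Type*} {L : Type u} [Field K]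
    [CommRing A] [IsReduced A] [Field L] [Algebra K A] [Algebra K L] (p : ℕ) [Fact p.Prime] [CharP K p]
    (hL : ∀ {ι : Type u} {v : ι → L}, LinearIndependent K v →
      LinearIndependent K fun i => v i ^ p) :
    IsReduced (A ⊗[K] L) := by
  rw [isReduced_iff_pow_one_lt p (Fact.out : p.Prime).one_lt]
  intro z hz
  let v := Module.Basis.ofVectorSpace K L
  obtain ⟨c, rfl⟩ := TensorProduct.eq_repr_basis_right v z
  rcases subsingleton_or_nontrivial (A ⊗[K] L) with _ | _
  · exact Subsingleton.elim _ _
  have : CharP (A ⊗[K] L) p := charP_of_injective_algebraMap (algebraMap K (A ⊗[K] L)).injective p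
  rw [Finsupp.sum, sum_pow_char] at hz
  simp only [Algebra.TensorProduct.tmul_pow] at hz
  obtain ⟨g, hg⟩ := LinearMap.exists_leftInverse_of_injective _
    (linearIndependent_iff_ker.mp (hL v.linearIndependent))
  have hgv (i) : g (v i ^ p) = Finsupp.single i 1 := by
    simpa using LinearMap.congr_fun hg (Finsupp.single i 1)
  refine Finset.sum_eq_zero fun i hi => ?_
  have h := congrArg (TensorProduct.rid K A ∘ (Finsupp.lapply i ∘ₗ g).lTensor A) hz
  simp only [Function.comp_apply, map_sum, LinearMap.lTensor_tmul, LinearMap.comp_apply, hgv,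
    Finsupp.lapply_apply, map_zero, TensorProduct.rid_tmul] at h
  rw [Finset.sum_eq_single_of_mem i hi fun j _ hj => by simp [hj],
    Finsupp.single_eq_same, one_smul] at h
  rw [show c i = 0 from eq_zero_of_pow_eq_zero h]
  exact TensorProduct.zero_tmul _ _

/-! ### Infinitesimal Hopf algebras -/

/-- The affine scheme `Spec H` with its unit section is infinitesimal: every function on it differs
from its value at the unit by a nilpotent. -/
def IsInfinitesimal (k H : Type*) [CommRing k] [CommRing H] [HopfAlgebra k H] : Prop :=
  ∀ h : H, IsNilpotent (h - algebraMap k H (Coalgebra.counit h))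

namespace TruncPoly

variable {k H : Type*} [CommRing k] [CommRing H] [HopfAlgebra k H] {e N : ℕ}

theorem X_pow_eq_zero (i : Fin e) :
    (Ideal.Quotient.mk _ (MvPolynomial.X i) : TruncPoly k e N) ^ N = 0 := by
  rw [← map_pow, Ideal.Quotient.eq_zero_iff_mem]
  exact Ideal.subset_span ⟨i, rfl⟩

/-- As `k` is reduced, the unit of a group scheme with coordinate ring `k[X] / (X ^ N)` is the
origin. -/
theorem counit_mk [IsReduced k] (φ : TruncPoly k e N ≃ₐ[k] H) (f : MvPolynomial (Fin e) k) :
    Coalgebra.counit (R := k) (φ (Ideal.Quotient.mk _ f)) = MvPolynomial.constantCoeff f := by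
  have h : (((Bialgebra.counitAlgHom k H).comp φ.toAlgHom).comp (Ideal.Quotient.mkₐ k _)) =
      MvPolynomial.aeval (fun _ => (0 : k)) := by
    ext i
    have : IsNilpotent (Coalgebra.counit (R := k)
        (φ (Ideal.Quotient.mk _ (MvPolynomial.X i)))) := by
      refine ⟨N, ?_⟩
      rw [← Bialgebra.counitAlgHom_apply, ← map_pow, ← map_pow, X_pow_eq_zero, map_zero, map_zero]
    simpa using this.eq_zero
  simpa [MvPolynomial.aeval_zero'] using AlgHom.congr_fun h f

theorem isInfinitesimal (φ : TruncPoly k e N ≃ₐ[k] H) : IsInfinitesimal k H := by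
  intro h
  obtain ⟨f, rfl⟩ := (φ.surjective.comp Ideal.Quotient.mk_surjective) h
  simp only [Function.comp_apply]
  induction f using MvPolynomial.induction_on with
  | C a =>
    have : φ (Ideal.Quotient.mk _ (MvPolynomial.C a)) = algebraMap k H a := φ.commutes a
    rw [this, Bialgebra.counit_algebraMap, sub_self]
    exact IsNilpotent.zero
  | add f g hf hg =>
    rw [map_add, map_add, map_add, map_add, add_sub_add_comm]
    exact (Commute.all _ _).isNilpotent_add hf hg
  | mul_X f i hf =>
    have hX : IsNilpotent (φ (Ideal.Quotient.mk _ (MvPolynomial.X i))) :=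
      ⟨N, by rw [← map_pow, X_pow_eq_zero, map_zero]⟩
    have hX' := hX.map ((Algebra.ofId k H).comp (Bialgebra.counitAlgHom k H))
    rw [map_mul, map_mul, Bialgebra.counit_mul, map_mul]
    exact (Commute.all _ _).isNilpotent_sub ((Commute.all _ _).isNilpotent_mul_left hX)
      ((Commute.all _ _).isNilpotent_mul_left hX')

theorem coeff_single_mul (hN : 1 < N) (i : Fin e) (f g : MvPolynomial (Fin e) k) :
    coeff (Finsupp.single i 1) (Ideal.Quotient.mk _ (f * g) : TruncPoly k e N) =
      MvPolynomial.constantCoeff f *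
        coeff (Finsupp.single i 1) (Ideal.Quotient.mk _ g : TruncPoly k e N) +
      MvPolynomial.constantCoeff g *
        coeff (Finsupp.single i 1) (Ideal.Quotient.mk _ f : TruncPoly k e N) := by
  classical
  have hn (j : Fin e) : Finsupp.single i 1 j < N := by
    rw [Finsupp.single_apply]; split_ifs <;> omega
  rw [coeff_mk hn, coeff_mk hn, coeff_mk hn, MvPolynomial.coeff_mul, Finsupp.antidiagonal_single,
    Finset.sum_map, Finset.Nat.antidiagonal_succ]
  simp [MvPolynomial.constantCoeff_eq, mul_comm]

end TruncPoly

/-! ### Actions as homomorphisms of algebras -/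

namespace GDerivation

variable {k H R S : Type*} [CommRing k] [CommRing H] [HopfAlgebra k H]
  [CommRing R] [Algebra k R] [CommRing S] [Algebra k S]

/-- Evaluation at the unit of `Spec H`, as a homomorphism of algebras `H ⊗ R → R`. -/
noncomputable def evalUnit (k H R : Type*) [CommRing k] [CommRing H] [HopfAlgebra k H]
    [CommRing R] [Algebra k R] : H ⊗[k] R →ₐ[k] R :=
  (Algebra.TensorProduct.lid k R).toAlgHom.comp
    (Algebra.TensorProduct.map (Bialgebra.counitAlgHom k H) (AlgHom.id k R))

theorem evalUnit_apply (x : H ⊗[k] R) :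
    evalUnit k H R x = TensorProduct.lid k R (Coalgebra.counit.rTensor R x) := rfl

@[simp]
theorem evalUnit_tmul (h : H) (r : R) :
    evalUnit k H R (h ⊗ₜ r) = Coalgebra.counit (R := k) h • r := by
  simp [evalUnit_apply]

theorem evalUnit_coact (D : GDerivation k H R) (r : R) :
    evalUnit k H R (D.toAlgHom r) = r :=
  D.counit_coact r

/-- The functor `H ⊗ -` on homomorphisms of algebras. -/
noncomputable abbrev lTensorAlg (H : Type*) [CommRing H] [HopfAlgebra k H] (f : R →ₐ[k] S) :
    H ⊗[k] R →ₐ[k] H ⊗[k] S :=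
  Algebra.TensorProduct.map (AlgHom.id k H) f

/-- The map `H ⊗ R → H ⊗ (H ⊗ R)` induced by the group law of `Spec H`. -/
noncomputable def comulAlg (k H R : Type*) [CommRing k] [CommRing H] [HopfAlgebra k H]
    [CommRing R] [Algebra k R] : H ⊗[k] R →ₐ[k] H ⊗[k] (H ⊗[k] R) :=
  (Algebra.TensorProduct.assoc k k k H H R).toAlgHom.comp
    (Algebra.TensorProduct.map (Bialgebra.comulAlgHom k H) (AlgHom.id k R))

theorem comulAlg_apply (x : H ⊗[k] R) :
    comulAlg k H R x = TensorProduct.assoc k H H R (Coalgebra.comul.rTensor R x) := rfl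

theorem evalUnit_lTensorAlg (f : R →ₐ[k] S) (x : H ⊗[k] R) :
    evalUnit k H S (lTensorAlg H f x) = f (evalUnit k H R x) := by
  suffices (evalUnit k H S).comp (lTensorAlg H f) = f.comp (evalUnit k H R) from
    AlgHom.congr_fun this x
  ext <;> simp

theorem comulAlg_lTensorAlg (f : R →ₐ[k] S) (x : H ⊗[k] R) :
    comulAlg k H S (lTensorAlg H f x) = lTensorAlg H (lTensorAlg H f) (comulAlg k H R x) := by
  induction x with
  | zero => simp
  | add x y hx hy => simp only [map_add, hx, hy]
  | tmul h r =>
    simp only [lTensorAlg, Algebra.TensorProduct.map_tmul, comulAlg_apply,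
      LinearMap.rTensor_tmul, AlgHom.id_apply]
    induction Coalgebra.comul (R := k) h with
    | zero => simp
    | add x y hx hy => simp only [TensorProduct.add_tmul, map_add, hx, hy]
    | tmul a b => simp

theorem evalUnit_of_comp_eq {D : GDerivation k H R} {δ : S →ₐ[k] H ⊗[k] S} {f : R →ₐ[k] S}
    (h : δ.comp f = (lTensorAlg H f).comp D.toAlgHom) :
    ((evalUnit k H S).comp δ).comp f = (AlgHom.id k S).comp f := by
  ext r
  have hr : δ (f r) = lTensorAlg H f (D.toAlgHom r) := AlgHom.congr_fun h r
  simp [hr, evalUnit_lTensorAlg, evalUnit_coact]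

theorem comulAlg_of_comp_eq {D : GDerivation k H R} {δ : S →ₐ[k] H ⊗[k] S} {f : R →ₐ[k] S}
    (h : δ.comp f = (lTensorAlg H f).comp D.toAlgHom) :
    ((comulAlg k H S).comp δ).comp f = ((lTensorAlg H δ).comp δ).comp f := by
  ext r
  have hr : δ (f r) = lTensorAlg H f (D.toAlgHom r) := AlgHom.congr_fun h r
  have hD : comulAlg k H R (D.toAlgHom r) = lTensorAlg H D.toAlgHom (D.toAlgHom r) :=
    D.coassoc r
  simp only [AlgHom.comp_apply, hr, comulAlg_lTensorAlg, hD]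
  rw [← AlgHom.comp_apply, ← AlgHom.comp_apply (lTensorAlg H δ),
    ← Algebra.TensorProduct.map_id_comp, ← Algebra.TensorProduct.map_id_comp, h]

/-- A coaction given by identities between homomorphisms of algebras, which may be checked on
generators. -/
noncomputable def ofAlgHom (δ : S →ₐ[k] H ⊗[k] S)
    (h₁ : (evalUnit k H S).comp δ = AlgHom.id k S)
    (h₂ : (comulAlg k H S).comp δ = (lTensorAlg H δ).comp δ) : GDerivation k H S where
  toAlgHom := δ
  counit_coact := AlgHom.congr_fun h₁
  coassoc := AlgHom.congr_fun h₂

theorem isHom_iff {D : GDerivation k H R} {E : GDerivation k H S} {f : R →ₐ[k] S} :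
    D.IsHom E f ↔ E.toAlgHom.comp f = (lTensorAlg H f).comp D.toAlgHom :=
  ⟨fun h => AlgHom.ext h, fun h => AlgHom.congr_fun h⟩

theorem IsHom.comp {T : Type*} [CommRing T] [Algebra k T] {D : GDerivation k H R}
    {E : GDerivation k H S} {F : GDerivation k H T} {f : R →ₐ[k] S} {g : S →ₐ[k] T}
    (hg : E.IsHom F g) (hf : D.IsHom E f) : D.IsHom F (g.comp f) := by
  intro r
  rw [AlgHom.comp_apply, hg, hf, AlgHom.comp_toLinearMap, LinearMap.lTensor_comp_apply]

/-! ### The components of weight one -/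

variable {e N : ℕ}

theorem IsHom.component {φ : TruncPoly k e N ≃ₐ[k] H} {D : GDerivation k H R}
    {E : GDerivation k H S} {f : R →ₐ[k] S} (hf : D.IsHom E f) (n : Fin e →₀ ℕ) (r : R) :
    E.component φ n (f r) = f (D.component φ n r) := by
  simp only [GDerivation.component, LinearMap.comp_apply, AlgHom.toLinearMap_apply, hf r]
  induction D.toAlgHom r with
  | zero => simp
  | add x y hx hy => simp only [map_add, hx, hy]
  | tmul h r => simp

/-- The components of weight one of an action are derivations, since they differentiate along
tangent vectors at the unit. -/
noncomputable def derivation [IsReduced k] (hN : 1 < N) (φ : TruncPoly k e N ≃ₐ[k] H)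
    (D : GDerivation k H R) (i : Fin e) : Derivation k R R :=
  Derivation.mk' (D.component φ (Finsupp.single i 1)) <| by
    have hmul (h h' : H) :
        TruncPoly.coeff (Finsupp.single i 1) (φ.symm (h * h')) =
          Coalgebra.counit (R := k) h * TruncPoly.coeff (Finsupp.single i 1) (φ.symm h') +
          Coalgebra.counit (R := k) h' * TruncPoly.coeff (Finsupp.single i 1) (φ.symm h) := by
      obtain ⟨f, rfl⟩ := (φ.surjective.comp Ideal.Quotient.mk_surjective) h
      obtain ⟨g, rfl⟩ := (φ.surjective.comp Ideal.Quotient.mk_surjective) h'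
      simp only [Function.comp_apply, ← map_mul, AlgEquiv.symm_apply_apply, TruncPoly.counit_mk]
      exact TruncPoly.coeff_single_mul hN i f g
    let Δ : H ⊗[k] R →ₗ[k] R := (TensorProduct.lid k R).toLinearMap ∘ₗ
      ((TruncPoly.coeff (Finsupp.single i 1)).comp φ.symm.toLinearMap).rTensor R
    have hΔ (x y : H ⊗[k] R) :
        Δ (x * y) = evalUnit k H R x • Δ y + evalUnit k H R y • Δ x := by
      induction x with
      | zero => simp
      | add x x' hx hx' => simp only [add_mul, map_add, hx, hx', add_smul, smul_add]; abel
      | tmul h r =>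
        induction y with
        | zero => simp
        | add y y' hy hy' => simp only [mul_add, map_add, hy, hy', add_smul, smul_add]; abel
        | tmul h' r' =>
          simp only [Δ, Algebra.TensorProduct.tmul_mul_tmul, LinearMap.comp_apply,
            LinearMap.rTensor_tmul, LinearEquiv.coe_coe, TensorProduct.lid_tmul,
            AlgEquiv.toLinearMap_apply, hmul, evalUnit_tmul, smul_eq_mul, Algebra.smul_def,
            (algebraMap k R).map_add, (algebraMap k R).map_mul]
          ring
    intro a b
    have := hΔ (D.toAlgHom a) (D.toAlgHom b)
    rwa [← map_mul, evalUnit_coact, evalUnit_coact] at this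

/-! ### Amalgamated tensor products -/

/-- A homomorphism over `k` out of `A ⊗[K] B`, where `K` is a `k`-algebra, is determined by its
restrictions to `A` and `B`. -/
theorem _root_.Algebra.TensorProduct.ext_restrictScalars {k K A B T : Type*} [CommRing k]
    [CommRing K] [CommRing A] [CommRing B] [CommRing T] [Algebra k A] [Algebra k B] [Algebra k T]
    [Algebra k K] [Algebra K A] [Algebra K B] [IsScalarTower k K A] [IsScalarTower k K B]
    {g h : A ⊗[K] B →ₐ[k] T}
    (e₁ : g.comp ((Algebra.TensorProduct.includeLeft : A →ₐ[K] A ⊗[K] B).restrictScalars k) =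
      h.comp ((Algebra.TensorProduct.includeLeft : A →ₐ[K] A ⊗[K] B).restrictScalars k))
    (e₂ : g.comp ((Algebra.TensorProduct.includeRight : B →ₐ[K] A ⊗[K] B).restrictScalars k) =
      h.comp ((Algebra.TensorProduct.includeRight : B →ₐ[K] A ⊗[K] B).restrictScalars k)) :
    g = h := by
  apply AlgHom.coe_ringHom_injective
  apply Algebra.TensorProduct.ringHom_ext
  · ext a; exact AlgHom.congr_fun e₁ a
  · ext a; exact AlgHom.congr_fun e₂ a

/-- The tensor product over `K` of two `𝔤`-rings over a `𝔤`-ring `K` carries an action of `𝔤`. -/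
theorem exists_tensorProduct {K L₁ L₂ : Type*} [CommRing K] [CommRing L₁] [CommRing L₂]
    [Algebra k K] [Algebra k L₁] [Algebra k L₂] [Algebra K L₁] [Algebra K L₂]
    [IsScalarTower k K L₁] [IsScalarTower k K L₂]
    {D : GDerivation k H K} {D₁ : GDerivation k H L₁} {D₂ : GDerivation k H L₂}
    (h₁ : D.IsHom D₁ (IsScalarTower.toAlgHom k K L₁))
    (h₂ : D.IsHom D₂ (IsScalarTower.toAlgHom k K L₂)) :
    ∃ E : GDerivation k H (L₁ ⊗[K] L₂),
      D₁.IsHom E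
        ((Algebra.TensorProduct.includeLeft : L₁ →ₐ[K] L₁ ⊗[K] L₂).restrictScalars k) ∧
      D₂.IsHom E
        ((Algebra.TensorProduct.includeRight : L₂ →ₐ[K] L₁ ⊗[K] L₂).restrictScalars k) := by
  let f₁ : L₁ →ₐ[k] L₁ ⊗[K] L₂ :=
    (Algebra.TensorProduct.includeLeft : L₁ →ₐ[K] L₁ ⊗[K] L₂).restrictScalars k
  let f₂ : L₂ →ₐ[k] L₁ ⊗[K] L₂ :=
    (Algebra.TensorProduct.includeRight : L₂ →ₐ[K] L₁ ⊗[K] L₂).restrictScalars k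
  have hf : f₁.comp (IsScalarTower.toAlgHom k K L₁) = f₂.comp (IsScalarTower.toAlgHom k K L₂) := by
    ext a
    simp [f₁, f₂]
  obtain ⟨δ, hδ₁, hδ₂⟩ : ∃ δ : L₁ ⊗[K] L₂ →ₐ[k] H ⊗[k] (L₁ ⊗[K] L₂),
      δ.comp f₁ = (lTensorAlg H f₁).comp D₁.toAlgHom ∧
      δ.comp f₂ = (lTensorAlg H f₂).comp D₂.toAlgHom := by
    let g₁ := (lTensorAlg H f₁).comp D₁.toAlgHom
    let g₂ := (lTensorAlg H f₂).comp D₂.toAlgHom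
    have hg : g₁.comp (IsScalarTower.toAlgHom k K L₁) =
        g₂.comp (IsScalarTower.toAlgHom k K L₂) := by
      simp only [g₁, g₂, AlgHom.comp_assoc, isHom_iff.mp h₁, isHom_iff.mp h₂]
      simp only [← AlgHom.comp_assoc, ← Algebra.TensorProduct.map_id_comp, hf]
    -- `K` acts on `H ⊗ (L₁ ⊗[K] L₂)` through its coaction, so that `g₁` and `g₂` are `K`-linear.
    let : Algebra K (H ⊗[k] (L₁ ⊗[K] L₂)) :=
      (g₁.comp (IsScalarTower.toAlgHom k K L₁)).toRingHom.toAlgebra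
    have : IsScalarTower k K (H ⊗[k] (L₁ ⊗[K] L₂)) :=
      .of_algebraMap_eq fun c => ((g₁.comp (IsScalarTower.toAlgHom k K L₁)).commutes c).symm
    let G₁ : L₁ →ₐ[K] H ⊗[k] (L₁ ⊗[K] L₂) := { g₁ with commutes' := fun _ => rfl }
    let G₂ : L₂ →ₐ[K] H ⊗[k] (L₁ ⊗[K] L₂) :=
      { g₂ with commutes' := fun a => (AlgHom.congr_fun hg a).symm }
    refine ⟨(Algebra.TensorProduct.lift G₁ G₂ fun _ _ => .all _ _).restrictScalars k, ?_, ?_⟩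
    · ext a
      simp [f₁, G₁, g₁]
    · ext a
      simp [f₂, G₂, g₂]
  refine ⟨ofAlgHom δ ?_ ?_, isHom_iff.mpr hδ₁, isHom_iff.mpr hδ₂⟩
  · exact Algebra.TensorProduct.ext_restrictScalars (evalUnit_of_comp_eq hδ₁)
      (evalUnit_of_comp_eq hδ₂)
  · exact Algebra.TensorProduct.ext_restrictScalars (comulAlg_of_comp_eq hδ₁)
      (comulAlg_of_comp_eq hδ₂)

/-! ### Localization -/

theorem isUnit_of_isUnit_evalUnit (hH : IsInfinitesimal k H) {x : H ⊗[k] R}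
    (hx : IsUnit (evalUnit k H R x)) : IsUnit x := by
  have hnil (y : H ⊗[k] R) : IsNilpotent (y - 1 ⊗ₜ evalUnit k H R y) := by
    induction y with
    | zero => simp
    | add y z hy hz =>
      rw [map_add, TensorProduct.tmul_add, add_sub_add_comm]
      exact (Commute.all _ _).isNilpotent_add hy hz
    | tmul h r =>
      have : h ⊗ₜ[k] r - 1 ⊗ₜ evalUnit k H R (h ⊗ₜ r) =
          (h - algebraMap k H (Coalgebra.counit h)) ⊗ₜ r := by
        rw [evalUnit_tmul, TensorProduct.sub_tmul, Algebra.algebraMap_eq_smul_one,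
          TensorProduct.smul_tmul]
      obtain ⟨n, hn⟩ := hH h
      rw [this]
      exact ⟨n, by rw [Algebra.TensorProduct.tmul_pow, hn, TensorProduct.zero_tmul]⟩
  rw [← sub_add_cancel x (1 ⊗ₜ evalUnit k H R x)]
  exact (hnil x).isUnit_add_right_of_commute
    (hx.map (Algebra.TensorProduct.includeRight : R →ₐ[k] H ⊗[k] R)) (.all _ _)

/-- Every localization of a `𝔤`-ring carries an action of `𝔤` when `𝔤` is infinitesimal: the
coaction is the identity modulo nilpotents, so it keeps the denominators invertible. -/
theorem exists_localization (hH : IsInfinitesimal k H) (D : GDerivation k H R) (W : Submonoid R)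
    [Algebra R S] [IsScalarTower k R S] [IsLocalization W S] :
    ∃ E : GDerivation k H S, D.IsHom E (IsScalarTower.toAlgHom k R S) := by
  let f := IsScalarTower.toAlgHom k R S
  have hu (s : W) : IsUnit (((lTensorAlg H f).comp D.toAlgHom) s) := by
    apply isUnit_of_isUnit_evalUnit hH
    rw [AlgHom.comp_apply, evalUnit_lTensorAlg, evalUnit_coact]
    exact IsLocalization.map_units S s
  let δ : S →ₐ[k] H ⊗[k] S := IsLocalization.liftAlgHom (M := W) hu
  have hδ : δ.comp f = (lTensorAlg H f).comp D.toAlgHom := by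
    ext r
    simp [δ, f]
  refine ⟨ofAlgHom δ ?_ ?_, isHom_iff.mpr hδ⟩
  · exact IsLocalization.algHom_ext W (evalUnit_of_comp_eq hδ)
  · exact IsLocalization.algHom_ext W (comulAlg_of_comp_eq hδ)

/-- A nonzero reduced `𝔤`-ring, with `𝔤` infinitesimal, maps to a `𝔤`-field, namely its
localization at a minimal prime ideal. -/
theorem exists_isHom_field {R : Type u} [CommRing R] [Algebra k R] [Nontrivial R]
    [IsReduced R] (hH : IsInfinitesimal k H) (D : GDerivation k H R) :
    ∃ (M : Type u) (_ : Field M) (_ : Algebra k M) (E : GDerivation k H M) (f : R →ₐ[k] M),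
      D.IsHom E f := by
  obtain ⟨P, hP⟩ := Ideal.nonempty_minimalPrimes (bot_ne_top (α := Ideal R))
  have := hP.1.1
  have : Ring.KrullDimLE 0 (Localization.AtPrime P) := .of_isLocalization _ hP _
  obtain ⟨E, hE⟩ := D.exists_localization (S := Localization.AtPrime P) hH P.primeCompl
  exact ⟨Localization.AtPrime P, Ring.KrullDimLE.isField_of_isReduced.toField,
    inferInstanceAs (Algebra k (Localization.AtPrime P)), E, _, hE⟩

end GDerivation

/-! ### Amalgamation over a strict field -/

theorem proposition3p22
    {p : ℕ} [Fact p.Prime] {k : Type u} [CommRing k] [CharP k p] [PerfectRing k p]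
    {e m : ℕ} (he : 0 < e) (hm : 0 < m)
    {H : Type v} [CommRing H] [HopfAlgebra k H] (φ : TruncPoly k e (p ^ m) ≃ₐ[k] H)
    {K : Type w} {L₁ : Type x} {L₂ : Type y} [Field K] [Field L₁] [Field L₂]
    [Algebra k K] [Algebra k L₁] [Algebra k L₂]
    (D : GDerivation k H K) (D₁ : GDerivation k H L₁) (D₂ : GDerivation k H L₂)
    (i₁ : K →ₐ[k] L₁) (i₂ : K →ₐ[k] L₂) (hi₁ : D.IsHom D₁ i₁) (hi₂ : D.IsHom D₂ i₂)
    (hD : D.IsStrict p φ) :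
    ∃ (M : Type (max x y)) (_ : Field M) (_ : Algebra k M) (E : GDerivation k H M)
      (j₁ : L₁ →ₐ[k] M) (j₂ : L₂ →ₐ[k] M),
      D₁.IsHom E j₁ ∧ D₂.IsHom E j₂ ∧ j₁.comp i₁ = j₂.comp i₂ := by
  have hp : p.Prime := Fact.out
  have hN : 1 < p ^ m := Nat.one_lt_pow hm.ne' hp.one_lt
  have : IsReduced k := (isReduced_iff_pow_one_lt p hp.one_lt).mpr fun c hc =>
    injective_frobenius k p (by rw [frobenius_def, hc, map_zero])
  let := i₁.toRingHom.toAlgebra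
  let := i₂.toRingHom.toAlgebra
  have : IsScalarTower k K L₁ := .of_algebraMap_eq fun c => (i₁.commutes c).symm
  have : IsScalarTower k K L₂ := .of_algebraMap_eq fun c => (i₂.commutes c).symm
  have : CharP K p := (CharP.charP_iff_prime_eq_zero hp).mpr <| by
    rw [← map_natCast (algebraMap k K), CharP.cast_eq_zero, map_zero]
  have : CharP L₂ p := charP_of_injective_algebraMap (algebraMap K L₂).injective p
  obtain ⟨E, hE₁, hE₂⟩ := GDerivation.exists_tensorProduct (D := D) (D₁ := D₁) (D₂ := D₂) hi₁ hi₂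
  have : IsReduced (L₁ ⊗[K] L₂) := by
    refine TensorProduct.isReduced_of_linearIndependent_pow p fun hv => ?_
    refine hv.pow_char_of_derivation p (fun i => D.component φ (Finsupp.single i 1))
      (fun i => (D₂.derivation hN φ i).restrictScalars ℤ) (fun i a => ?_) fun a ha => ?_
    · exact hi₂.component _ a
    · exact (hD ▸ ha : a ∈ Set.range fun r : K => r ^ p)
  obtain ⟨M, _, _, F, f, hf⟩ := E.exists_isHom_field (TruncPoly.isInfinitesimal φ)
  refine ⟨M, _, _, F, _, _, hf.comp hE₁, hf.comp hE₂, ?_⟩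
  ext a
  exact congrArg f (Algebra.TensorProduct.tmul_one_eq_one_tmul a)
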